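/- Let $\mathcal A$ be a finite set of agents and $\mathcal I$ a finite set of institutions; the set of contracts is $\mathcal X=\mathcal A\times\mathcal I$. For a set $X\subseteq\mathcal X$, let $X_a$ and $X_i$ denote the sets of contracts in $X$ of agent $a$ and of institution $i$. Each institution $i$ has a capacity $q_i\in\mathbb N$ and a priority order $\succ_i$, a linear order over $\mathcal X_i$. A problem is a profile $R=(R_a)_{a\in\mathcal A}$ of linear orders, $R_a$ over $\mathcal X_a\cup\{\emptyset\}$, where $\emptyset$ is the null contract; $P_a$ is the strict part of $R_a$, and a contract $x\in\mathcal X_a$ is acceptable to $a$ if $x\mathrel{R_a}\emptyset$. A matching is a set $X\subseteq\mathcal X$ with $|X_a|\le 1$ for every $a$; $X_a$ is identified with the contract it contains, or with $\emptyset$ if it is empty. A matching rule $\varphi$ assigns a matching $\varphi(R)$ to every problem $R$. A matching $X$ satisfies, at a problem $R$: (a) non-wastefulness, if for every institution $i$ we have $|X_i|\le q_i$, and $|X_i|=q_i$ whenever $x\mathrel{P_a}X_a$ for some agent $a$ and the contract $x=(a,i)$; (b) no justified envy, if there are no institution $i$ and contracts $x=(a,i)\notin X$ and $y=(b,i)\in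 X$ with $x\mathrel{P_a}X_a$ and $x\succ_i y$; (c) individual rationality, if $X_a\mathrel{R_a}\emptyset$ for every agent $a$. A matching rule satisfies one of these axioms if $\varphi(R)$ satisfies it at $R$ for every problem $R$. A matching rule $\varphi$ is strategy-proof if $\varphi_a(R)\mathrel{R_a}\varphi_a(R'_a,R_{-a})$ for every problem $R$, agent $a$ and preference relation $R'_a$ of $a$, where $\varphi_a(R)$ denotes what $a$ gets in $\varphi(R)$. The responsive choice rule $C^r_i$ chooses from each set $X_i\subseteq\mathcal X_i$ the contracts of highest priority with respect to $\succ_i$, one after the other, until $q_i$ contracts are chosen or no contract is left. The deferred-acceptance (DA) rule based on $(C^r_i)_{i\in\mathcal I}$ is the matching rule defined by the following algorithm. In Step 1, each agent proposes their most preferred acceptable contract (if any); in each later step, each agent whose contract was rejected in the previous step proposes their next most preferred acceptable contract (if any). In each step, each institution $i$ considers the contracts that it accepted tentatively in the previous step together with the new proposals to it; it accepts tentatively what $C^r_i$ chooses from them and rejects the others permanently. The algorithm stops at the first step without a rejection and returns the contracts accepted in that step. Claim: a matching rule satisfies non-wastefulness, no justified envy, individual rationality and strategy-proofness if and only if it is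 the DA rule based on $(C^r_i)_{i\in\mathcal I}$. -/

import Mathlib

/-!  Matching of agents `A` with institutions `I`, where every agent-institution pair is exactly one
contract: the set of contracts is `A × I`.  The contracts of agent `a` are the pairs `(a, i)`, and
are listed by `i : I`; the contracts of institution `i` are the pairs `(a, i)`, and are listed by
`a : A`.  The null contract is `none : Option I`. -/

namespace ContractMatching

/-- A linear order, given by its weak relation: `rel x y` reads "`x` is at least as good as `y`". -/
structure LinearRel (T : Type*) where
  rel : T → T → Prop
  isLinearOrder : IsLinearOrder T rel

/-- The strict part of a linear order. -/
def LinearRel.strict {T : Type*} (R : LinearRel T) (x y : T) : Prop :=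
  R.rel x y ∧ x ≠ y

/-- A preference relation of an agent `a` over `a`'s contracts (`some i` is the contract `(a, i)`)
and the null contract `none`. -/
abbrev Preference (I : Type*) := LinearRel (Option I)

/-- A priority order of an institution `i` over `i`'s contracts (`a` is the contract `(a, i)`). -/
abbrev Priority (A : Type*) := LinearRel A

/-- A matching problem: a preference relation for every agent. -/
abbrev Problem (A I : Type*) := A → Preference I

/-- A choice rule of an institution `i`, on sets of `i`'s contracts. -/
structure ChoiceRule (A : Type*) where
  choose : Finset A → Finset A
  choose_subset : ∀ S, choose S ⊆ S

section Finite

set_option linter.unusedSectionVars false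

variable {A I : Type*} [Fintype A] [Fintype I]

open Classical in
/-- The contracts of agent `a` in the set of contracts `X`. -/
noncomputable def agentPart (X : Finset (A × I)) (a : A) : Finset I :=
  Finset.univ.filter fun i => (a, i) ∈ X

open Classical in
/-- The contracts of institution `i` in the set of contracts `X`. -/
noncomputable def instPart (X : Finset (A × I)) (i : I) : Finset A :=
  Finset.univ.filter fun a => (a, i) ∈ X

/-- A matching: a set of contracts with at most one contract for each agent. -/
structure Matching (A I : Type*) [Fintype A] [Fintype I] where
  contracts : Finset (A × I)
  card_le_one : ∀ a, (agentPart contracts a).card ≤ 1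

open Classical in
/-- What agent `a` gets in the matching `X`: `a`'s contract, or the null contract. -/
noncomputable def Matching.assign (X : Matching A I) (a : A) : Option I :=
  if h : ∃ i, (a, i) ∈ X.contracts then some h.choose else none

theorem mem_agentPart {X : Finset (A × I)} {a : A} {i : I} :
    i ∈ agentPart X a ↔ (a, i) ∈ X := by
  simp [agentPart]

theorem mem_instPart {X : Finset (A × I)} {a : A} {i : I} :
    a ∈ instPart X i ↔ (a, i) ∈ X := by
  simp [instPart]

theorem Matching.assign_eq_some (X : Matching A I) (a : A) (i : I) :
    X.assign a = some i ↔ (a, i) ∈ X.contracts := by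
  unfold Matching.assign
  constructor
  · intro h
    split_ifs at h with h1
    have h2 := h1.choose_spec
    simp only [Option.some.injEq] at h
    rwa [h] at h2
  · intro h
    have h1 : ∃ i, (a, i) ∈ X.contracts := ⟨i, h⟩
    rw [dif_pos h1]
    exact congrArg some (Finset.card_le_one.1 (X.card_le_one a) _
      (mem_agentPart.2 h1.choose_spec) _ (mem_agentPart.2 h))

theorem Matching.assign_eq_none (X : Matching A I) (a : A) :
    X.assign a = none ↔ ∀ i, (a, i) ∉ X.contracts := by
  unfold Matching.assign
  split_ifs with h
  · simpa using h
  · simpa using h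

/-! ### Axioms on matchings and on matching rules -/

/-- `X_a R_a ∅` for every agent `a`. -/
def IndividuallyRational (R : Problem A I) (X : Matching A I) : Prop :=
  ∀ a, (R a).rel (X.assign a) none

/-- No institution exceeds its capacity, and an institution that some agent strictly prefers to
the own assignment fills its capacity. -/
def NonWasteful (q : I → ℕ) (R : Problem A I) (X : Matching A I) : Prop :=
  ∀ i, (instPart X.contracts i).card ≤ q i ∧
    ∀ a, (R a).strict (some i) (X.assign a) → (instPart X.contracts i).card = q i

/-- There are no institution `i` and contracts `x = (a, i)` outside `X` and `y = (b, i)` in `X`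
such that `a` strictly prefers `x` to the own assignment and `x` has priority over `y`. -/
def NoJustifiedEnvy (prio : I → Priority A) (R : Problem A I) (X : Matching A I) : Prop :=
  ∀ i, ¬ ∃ a b, (a, i) ∉ X.contracts ∧ (b, i) ∈ X.contracts ∧
    (R a).strict (some i) (X.assign a) ∧ (prio i).strict a b

/-- A matching rule. -/
abbrev MatchingRule (A I : Type*) [Fintype A] [Fintype I] := Problem A I → Matching A I

open Classical in
/-- No agent can gain by reporting another preference relation `R'`. -/
def StrategyProof (φ : MatchingRule A I) : Prop :=
  ∀ (R : Problem A I) (a : A) (R' : Preference I),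
    (R a).rel ((φ R).assign a) ((φ (Function.update R a R')).assign a)

/-! ### Responsive choice rules -/

open Classical in
/-- The contracts chosen from `S` in the first `k` rounds, when each round adds the contract of
highest priority that is still left (if any). -/
noncomputable def responsiveRounds (p : Priority A) (S : Finset A) : ℕ → Finset A
  | 0 => ∅
  | k + 1 => responsiveRounds p S k ∪
      (S \ responsiveRounds p S k).filter fun a => ∀ b ∈ S \ responsiveRounds p S k, p.rel a b

/-- The responsive choice rule with capacity `q` and priority order `p`: contracts of the highest
priority are chosen until the capacity is reached or no contract is left. -/
noncomputable def responsive (q : ℕ) (p : Priority A) : ChoiceRule A where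
  choose S := responsiveRounds p S q
  choose_subset S := by
    classical
    induction q with
    | zero => simp [responsiveRounds]
    | succ k ih =>
      unfold responsiveRounds
      exact Finset.union_subset ih ((Finset.filter_subset _ _).trans Finset.sdiff_subset)

/-! ### The deferred-acceptance rule -/

/-- `(a, i)` is the most preferred acceptable contract of `a` among the contracts which `a` has not
proposed before. -/
def IsNextProposal (R : Problem A I) (proposed : Finset (A × I)) (a : A) (i : I) : Prop :=
  (R a).rel (some i) none ∧ (a, i) ∉ proposed ∧
    ∀ j, (R a).rel (some j) none → (a, j) ∉ proposed → (R a).rel (some i) (some j)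

open Classical in
/-- The contracts proposed next by the agents that satisfy `active`, given the contracts that were
proposed before. -/
noncomputable def proposals (R : Problem A I) (proposed : Finset (A × I)) (active : A → Prop) :
    Finset (A × I) :=
  Finset.univ.filter fun x => active x.1 ∧ IsNextProposal R proposed x.1 x.2

open Classical in
/-- The contracts accepted when every institution `i` chooses from its part of `X`. -/
noncomputable def accepted (C : I → ChoiceRule A) (X : Finset (A × I)) : Finset (A × I) :=
  Finset.univ.filter fun x => x.1 ∈ (C x.2).choose (instPart X x.2)

/-- A step of the algorithm: the contracts which the institutions consider in this step, and all
contracts that were proposed in this step or before. -/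
structure DAState (A I : Type*) where
  considered : Finset (A × I)
  proposed : Finset (A × I)

open Classical in
/-- The steps of the deferred-acceptance algorithm; `daState C R s` is step `s + 1`. -/
noncomputable def daState (C : I → ChoiceRule A) (R : Problem A I) : ℕ → DAState A I
  | 0 => ⟨proposals R ∅ fun _ => True, proposals R ∅ fun _ => True⟩
  | s + 1 =>
    let old := daState C R s
    let new := proposals R old.proposed fun a =>
      ∃ i, (a, i) ∈ old.considered \ accepted C old.considered
    ⟨accepted C old.considered ∪ new, old.proposed ∪ new⟩

open Classical in
/-- No institution rejects a contract in the given step. -/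
def NoRejection (C : I → ChoiceRule A) (R : Problem A I) (s : ℕ) : Prop :=
  (daState C R s).considered \ accepted C (daState C R s).considered = ∅

theorem accepted_subset (C : I → ChoiceRule A) (X : Finset (A × I)) : accepted C X ⊆ X := by
  intro x hx
  simp only [accepted, Finset.mem_filter, Finset.mem_univ, true_and] at hx
  exact mem_instPart.1 ((C x.2).choose_subset _ hx)

theorem mem_proposals {R : Problem A I} {P : Finset (A × I)} {active : A → Prop} {a : A} {i : I} :
    (a, i) ∈ proposals R P active ↔ active a ∧ IsNextProposal R P a i := by
  simp [proposals]

theorem proposals_unique (R : Problem A I) (P : Finset (A × I)) (active : A → Prop) (a : A)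
    (i j : I) (hi : (a, i) ∈ proposals R P active) (hj : (a, j) ∈ proposals R P active) :
    i = j := by
  rw [mem_proposals] at hi hj
  have := (R a).isLinearOrder
  exact Option.some.inj (antisymm_of (R a).rel
    (hi.2.2.2 j hj.2.1 hj.2.2.1) (hj.2.2.2 i hi.2.1 hi.2.2.1))

theorem considered_subset_proposed (C : I → ChoiceRule A) (R : Problem A I) (s : ℕ) :
    (daState C R s).considered ⊆ (daState C R s).proposed := by
  classical
  induction s with
  | zero => exact subset_rfl
  | succ s ih =>
    intro x hx
    simp only [daState, Finset.mem_union] at hx ⊢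
    exact hx.imp_left fun h => ih (accepted_subset C _ h)

theorem considered_unique (C : I → ChoiceRule A) (R : Problem A I) (s : ℕ) :
    ∀ a i j, (a, i) ∈ (daState C R s).considered → (a, j) ∈ (daState C R s).considered →
      i = j := by
  classical
  induction s with
  | zero => exact fun a i j => proposals_unique R _ _ a i j
  | succ s ih =>
    have key : ∀ a i j, (a, i) ∈ accepted C (daState C R s).considered →
        (a, j) ∈ proposals R (daState C R s).proposed (fun a =>
          ∃ i, (a, i) ∈ (daState C R s).considered \ accepted C (daState C R s).considered) →
        False := by
      intro a i j hi hj
      simp only [proposals, Finset.mem_filter, Finset.mem_univ, true_and] at hj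
      obtain ⟨k, hk⟩ := hj.1
      rw [Finset.mem_sdiff] at hk
      have := ih a i k (accepted_subset C _ hi) hk.1
      exact hk.2 (this ▸ hi)
    intro a i j hi hj
    simp only [daState, Finset.mem_union] at hi hj
    rcases hi with hi | hi <;> rcases hj with hj | hj
    · exact ih a i j (accepted_subset C _ hi) (accepted_subset C _ hj)
    · exact (key a i j hi hj).elim
    · exact (key a j i hj hi).elim
    · exact proposals_unique R _ _ a i j hi hj

/-- The algorithm stops. -/
theorem exists_noRejection (C : I → ChoiceRule A) (R : Problem A I) :
    ∃ s, NoRejection C R s := by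
  classical
  by_contra! hne
  have grow : ∀ s, s ≤ ((daState C R s).proposed \ (daState C R s).considered).card := by
    intro s
    induction s with
    | zero => exact Nat.zero_le _
    | succ s ih =>
      refine Nat.succ_le_of_lt (ih.trans_lt (Finset.card_lt_card ?_))
      obtain ⟨x, hx⟩ := Finset.nonempty_iff_ne_empty.2 (hne s)
      have mem : ∀ y ∈ (daState C R s).proposed, y ∉ accepted C (daState C R s).considered →
          y ∈ (daState C R (s + 1)).proposed \ (daState C R (s + 1)).considered := by
        intro y hy hy'
        simp only [daState, Finset.mem_sdiff, Finset.mem_union, not_or]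
        refine ⟨Or.inl hy, hy', ?_⟩
        exact fun h => (mem_proposals.1 h).2.2.1 hy
      rw [Finset.ssubset_iff_of_subset]
      · rw [Finset.mem_sdiff] at hx
        refine ⟨x, mem x (considered_subset_proposed C R s hx.1) hx.2, ?_⟩
        simp [hx.1]
      · intro y hy
        rw [Finset.mem_sdiff] at hy
        exact mem y hy.1 fun h => hy.2 (accepted_subset C _ h)
  have h1 := grow (Fintype.card (A × I) + 1)
  have h2 := Finset.card_le_univ ((daState C R (Fintype.card (A × I) + 1)).proposed \
    (daState C R (Fintype.card (A × I) + 1)).considered)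
  omega

open Classical in
/-- The deferred-acceptance rule based on the choice rules `C`: at each problem, the contracts
accepted at the first step of the algorithm without a rejection. -/
noncomputable def deferredAcceptance (C : I → ChoiceRule A) : MatchingRule A I := fun R =>
  { contracts := accepted C (daState C R (Nat.find (exists_noRejection C R))).considered
    card_le_one := fun a => Finset.card_le_one.2 fun i hi j hj =>
      considered_unique C R _ a i j (accepted_subset C _ (mem_agentPart.1 hi))
        (accepted_subset C _ (mem_agentPart.1 hj)) }

end Finite

end ContractMatching

open ContractMatching

/-! Call a matching stable if it satisfies the three axioms on matchings. Two classical facts carry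
both directions. Deferred acceptance gives the agent-optimal stable matching
(`isStable_responsiveDA`, `responsiveDA_rel_of_isStable`), because no institution ever rejects a
contract of a stable matching. And every stable matching matches all agents that deferred acceptance
matches (`matched_of_matched_responsiveDA`), by counting contracts.

The link to incentives is truncation. If some stable matching gives `i` to `a`, it stays stable when
`a` declares only `i` acceptable, so every stable matching then gives `i` to `a`. For uniqueness,
let `i` be what deferred acceptance gives to `a`: a stable strategy-proof rule must give `a`
something at least as good as `i`, and optimality forbids anything better. For strategy-proofness, a
profitable misreport is confronted with the true preference truncated just below the contract
gained. -/

namespace ContractMatching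

/-! ### Linear relations -/

namespace LinearRel

variable {T : Type*} (R : LinearRel T)

theorem rel_refl (x : T) : R.rel x x :=
  have := R.isLinearOrder
  refl_of R.rel x

theorem rel_trans {x y z : T} (h : R.rel x y) (h' : R.rel y z) : R.rel x z :=
  have := R.isLinearOrder
  trans_of R.rel h h'

theorem rel_antisymm {x y : T} (h : R.rel x y) (h' : R.rel y x) : x = y :=
  have := R.isLinearOrder
  antisymm_of R.rel h h'

theorem rel_total (x y : T) : R.rel x y ∨ R.rel y x :=
  have := R.isLinearOrder
  total_of R.rel x y

theorem not_rel_iff_strict {x y : T} : ¬ R.rel x y ↔ R.strict y x := by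
  constructor
  · intro h
    refine ⟨(R.rel_total x y).resolve_left h, ?_⟩
    rintro rfl
    exact h (R.rel_refl _)
  · exact fun h h' => h.2 (R.rel_antisymm h.1 h')

theorem strict_trans {x y z : T} (h : R.strict x y) (h' : R.strict y z) : R.strict x z := by
  refine ⟨R.rel_trans h.1 h'.1, ?_⟩
  rintro rfl
  exact h.2 (R.rel_antisymm h.1 h'.1)

theorem exists_best (S : Finset T) (hS : S.Nonempty) : ∃ m ∈ S, ∀ b ∈ S, R.rel m b := by
  classical
  induction hS using Finset.Nonempty.cons_induction with
  | singleton a => exact ⟨a, by simp, by simpa using R.rel_refl a⟩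
  | cons a s ha hs ih =>
    obtain ⟨m, hm, hb⟩ := ih
    rcases R.rel_total a m with h | h
    · refine ⟨a, by simp, fun b hb' => ?_⟩
      rcases Finset.mem_cons.1 hb' with rfl | hb'
      · exact R.rel_refl _
      · exact R.rel_trans h (hb b hb')
    · refine ⟨m, by simp [hm], fun b hb' => ?_⟩
      rcases Finset.mem_cons.1 hb' with rfl | hb'
      · exact h
      · exact hb b hb'

/-- The linear order which compares by `t` first and by `R` within each level of `t`. -/
def lexBy (t : T → ℕ) : LinearRel T where
  rel x y := t x < t y ∨ (t x = t y ∧ R.rel x y)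
  isLinearOrder :=
    { refl := fun x => Or.inr ⟨rfl, R.rel_refl x⟩
      trans := by
        rintro x y z (h | ⟨h, h1⟩) (h' | ⟨h', h1'⟩)
        · exact Or.inl (h.trans h')
        · exact Or.inl (h' ▸ h)
        · exact Or.inl (h ▸ h')
        · exact Or.inr ⟨h.trans h', R.rel_trans h1 h1'⟩
      antisymm := by
        rintro x y (h | ⟨h, h1⟩) (h' | ⟨h', h1'⟩)
        · omega
        · omega
        · omega
        · exact R.rel_antisymm h1 h1'
      total := by
        intro x y
        rcases lt_trichotomy (t x) (t y) with h | h | h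
        · exact Or.inl (Or.inl h)
        · exact (R.rel_total x y).imp (fun h' => Or.inr ⟨h, h'⟩) fun h' => Or.inr ⟨h.symm, h'⟩
        · exact Or.inr (Or.inl h) }

end LinearRel

/-! ### Truncated preferences -/

section Preferences

variable {I : Type*}

open Classical in
/-- The level of a contract when exactly the contracts with institutions in `S` are acceptable. -/
noncomputable def acceptLevel (S : Set I) : Option I → ℕ
  | none => 1
  | some j => if j ∈ S then 0 else 2

/-- The preference relation that ranks the contracts with institutions in `S` as `R` does, and
finds all others unacceptable. -/
noncomputable def acceptOnly (R : Preference I) (S : Set I) : Preference I :=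
  R.lexBy (acceptLevel S)

theorem acceptOnly_rel_some_none {R : Preference I} {S : Set I} {j : I} :
    (acceptOnly R S).rel (some j) none ↔ j ∈ S := by
  by_cases h : j ∈ S <;> simp [acceptOnly, LinearRel.lexBy, acceptLevel, h]

theorem acceptOnly_rel_some_some {R : Preference I} {S : Set I} {j k : I} (hk : k ∈ S) :
    (acceptOnly R S).rel (some j) (some k) ↔ j ∈ S ∧ R.rel (some j) (some k) := by
  by_cases h : j ∈ S <;> simp [acceptOnly, LinearRel.lexBy, acceptLevel, h, hk]

end Preferences

/-! ### Responsive choice -/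

section Responsive

variable {A : Type*}

theorem responsiveRounds_subset [Fintype A] (p : Priority A) (S : Finset A) (k : ℕ) :
    responsiveRounds p S k ⊆ S :=
  (responsive k p).choose_subset S

theorem responsiveRounds_succ_of_best [Fintype A] (p : Priority A) (S : Finset A) (k : ℕ) {m : A}
    (hm : m ∈ S) (hm' : m ∉ responsiveRounds p S k)
    (hb : ∀ b ∈ S, b ∉ responsiveRounds p S k → p.rel m b) (x : A) :
    x ∈ responsiveRounds p S (k + 1) ↔ x ∈ responsiveRounds p S k ∨ x = m := by
  simp only [responsiveRounds, Finset.mem_union, Finset.mem_filter, Finset.mem_sdiff]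
  refine or_congr_right ⟨fun h => p.rel_antisymm (h.2 m ⟨hm, hm'⟩) (hb x h.1.1 h.1.2), ?_⟩
  rintro rfl
  exact ⟨⟨hm, hm'⟩, fun b h => hb b h.1 h.2⟩

/-- By antisymmetry each round adds exactly one element while any is left. Apart from
`choose_subset`, this is all that the later proofs use about responsive choice. -/
theorem responsiveRounds_spec [Fintype A] (p : Priority A) (S : Finset A) (k : ℕ) :
    (responsiveRounds p S k).card = min k S.card ∧
      ∀ x ∈ responsiveRounds p S k, ∀ y ∈ S, y ∉ responsiveRounds p S k → p.rel x y := by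
  classical
  induction k with
  | zero => simp [responsiveRounds]
  | succ k ih =>
    obtain ⟨hc, hp⟩ := ih
    have hsub := responsiveRounds_subset p S k
    by_cases hne : (S \ responsiveRounds p S k).Nonempty
    · obtain ⟨m, hm, hb⟩ := p.exists_best _ hne
      rw [Finset.mem_sdiff] at hm
      have hb' : ∀ b ∈ S, b ∉ responsiveRounds p S k → p.rel m b :=
        fun b h h' => hb b (Finset.mem_sdiff.2 ⟨h, h'⟩)
      have key := responsiveRounds_succ_of_best p S k hm.1 hm.2 hb'
      constructor
      · have : responsiveRounds p S (k + 1) = insert m (responsiveRounds p S k) := by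
          ext x
          rw [key, Finset.mem_insert, or_comm]
        rw [this, Finset.card_insert_of_notMem hm.2, hc]
        have := Finset.card_lt_card (Finset.ssubset_iff_subset_ne.2
          ⟨hsub, fun h => hm.2 (h.symm.subset hm.1)⟩)
        omega
      · intro x hx y hy hy'
        rw [key, not_or] at hy'
        rcases (key x).1 hx with hx | rfl
        · exact hp x hx y hy hy'.1
        · exact hb' y hy hy'.1
    · rw [Finset.not_nonempty_iff_eq_empty] at hne
      have heq : responsiveRounds p S k = S :=
        hsub.antisymm (Finset.sdiff_eq_empty_iff_subset.1 hne)
      have heq' : responsiveRounds p S (k + 1) = S := by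
        simp [responsiveRounds, heq]
      refine ⟨?_, fun x _ y hy hy' => (hy' (heq'.symm.subset hy)).elim⟩
      rw [heq']
      rw [heq] at hc
      omega

end Responsive

section Finite

set_option linter.unusedSectionVars false

variable {A I : Type*} [Fintype A] [Fintype I]

/-- The matching satisfies the three axioms on matchings. -/
structure IsStable (q : I → ℕ) (prio : I → Priority A) (R : Problem A I) (X : Matching A I) :
    Prop where
  nonWasteful : NonWasteful q R X
  noJustifiedEnvy : NoJustifiedEnvy prio R X
  individuallyRational : IndividuallyRational R X

theorem Matching.ext_assign {X Y : Matching A I} (h : ∀ a, X.assign a = Y.assign a) : X = Y := by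
  have : X.contracts = Y.contracts := by
    ext ⟨a, i⟩
    rw [← X.assign_eq_some, ← Y.assign_eq_some, h]
  cases X
  cases Y
  cases this
  rfl

/-! ### Invariants of deferred acceptance -/

section Invariants

variable (q : I → ℕ) (prio : I → Priority A) (R : Problem A I)

/-- The profile of responsive choice rules. -/
noncomputable abbrev responsiveProfile : I → ChoiceRule A := fun i => responsive (q i) (prio i)

theorem instPart_accepted (C : I → ChoiceRule A) (X : Finset (A × I)) (i : I) :
    instPart (accepted C X) i = (C i).choose (instPart X i) := by
  ext a
  rw [mem_instPart]
  simp [accepted]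

theorem instPart_mono {X Y : Finset (A × I)} (h : X ⊆ Y) (i : I) : instPart X i ⊆ instPart Y i :=
  fun _ ha => mem_instPart.2 (h (mem_instPart.1 ha))

theorem card_instPart_accepted (X : Finset (A × I)) (i : I) :
    (instPart (accepted (responsiveProfile q prio) X) i).card = min (q i) (instPart X i).card := by
  rw [instPart_accepted]
  exact (responsiveRounds_spec (prio i) (instPart X i) (q i)).1

theorem strict_of_mem_accepted {X : Finset (A × I)} {i : I} {a b : A}
    (hb : (b, i) ∈ accepted (responsiveProfile q prio) X) (ha : (a, i) ∈ X)
    (ha' : (a, i) ∉ accepted (responsiveProfile q prio) X) : (prio i).strict b a := by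
  refine ⟨?_, fun h => ha' (h ▸ hb)⟩
  rw [← mem_instPart, instPart_accepted] at hb ha'
  exact (responsiveRounds_spec (prio i) (instPart X i) (q i)).2 b hb a (mem_instPart.2 ha) ha'

theorem card_instPart_accepted_of_rejected {X : Finset (A × I)} {i : I} {a : A}
    (ha : (a, i) ∈ X) (ha' : (a, i) ∉ accepted (responsiveProfile q prio) X) :
    (instPart (accepted (responsiveProfile q prio) X) i).card = q i := by
  have h1 := card_instPart_accepted q prio X i
  have h2 : (instPart (accepted (responsiveProfile q prio) X) i).card < (instPart X i).card :=
    Finset.card_lt_card (Finset.ssubset_iff_subset_ne.2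
      ⟨instPart_mono (accepted_subset _ X) i,
        fun h => ha' (mem_instPart.1 (h.symm.subset (mem_instPart.2 ha)))⟩)
  omega

theorem mem_considered_succ {C : I → ChoiceRule A} {s : ℕ} {x : A × I} :
    x ∈ (daState C R (s + 1)).considered ↔ x ∈ accepted C (daState C R s).considered ∨
      x ∈ proposals R (daState C R s).proposed fun a =>
        ∃ i, (a, i) ∈ (daState C R s).considered ∧
          (a, i) ∉ accepted C (daState C R s).considered := by
  simp [daState]

theorem mem_proposed_succ {C : I → ChoiceRule A} {s : ℕ} {x : A × I} :
    x ∈ (daState C R (s + 1)).proposed ↔ x ∈ (daState C R s).proposed ∨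
      x ∈ proposals R (daState C R s).proposed fun a =>
        ∃ i, (a, i) ∈ (daState C R s).considered ∧
          (a, i) ∉ accepted C (daState C R s).considered := by
  simp [daState]

/-- New proposals are considered at once, so a proposed contract that is not under consideration was
lost at an earlier step. This drives the inductions over steps. -/
theorem proposed_of_proposed_succ {C : I → ChoiceRule A} {s : ℕ} {x : A × I}
    (h : x ∈ (daState C R (s + 1)).proposed) (h' : x ∉ (daState C R (s + 1)).considered) :
    x ∈ (daState C R s).proposed ∧ x ∉ accepted C (daState C R s).considered := by
  rw [mem_considered_succ, not_or] at h'
  exact ⟨((mem_proposed_succ R).1 h).resolve_right h'.2, h'.1⟩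

theorem exists_mem_notMem_of_card_le {T : Type*} {P Q : Finset T} (hcard : Q.card ≤ P.card) {b : T}
    (hb : b ∈ Q) (hb' : b ∉ P) : ∃ c ∈ P, c ∉ Q := by
  by_contra! h
  exact hb' ((Finset.eq_of_subset_of_card_le h hcard).symm.subset hb)

/-- Institutions that rejected a contract are full, with contracts of higher priority. -/
theorem rejected_spec (s : ℕ) {a : A} {i : I}
    (h : (a, i) ∈ (daState (responsiveProfile q prio) R s).proposed)
    (h' : (a, i) ∉ accepted (responsiveProfile q prio)
      (daState (responsiveProfile q prio) R s).considered) :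
    (instPart (accepted (responsiveProfile q prio)
        (daState (responsiveProfile q prio) R s).considered) i).card = q i ∧
      ∀ b, (b, i) ∈ accepted (responsiveProfile q prio)
        (daState (responsiveProfile q prio) R s).considered → (prio i).strict b a := by
  induction s with
  | zero =>
    exact ⟨card_instPart_accepted_of_rejected q prio h h',
      fun b hb => strict_of_mem_accepted q prio hb h h'⟩
  | succ s ih =>
    by_cases hc : (a, i) ∈ (daState (responsiveProfile q prio) R (s + 1)).considered
    · exact ⟨card_instPart_accepted_of_rejected q prio hc h',
        fun b hb => strict_of_mem_accepted q prio hb hc h'⟩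
    obtain ⟨h1, h2⟩ := proposed_of_proposed_succ R h hc
    obtain ⟨ihc, ihp⟩ := ih h1 h2
    have hsub : accepted (responsiveProfile q prio)
        (daState (responsiveProfile q prio) R s).considered ⊆
        (daState (responsiveProfile q prio) R (s + 1)).considered :=
      fun x hx => (mem_considered_succ R).2 (Or.inl hx)
    have hcard := card_instPart_accepted q prio
      (daState (responsiveProfile q prio) R (s + 1)).considered i
    have hle := Finset.card_le_card (instPart_mono hsub i)
    have hq : (instPart (accepted (responsiveProfile q prio)
        (daState (responsiveProfile q prio) R (s + 1)).considered) i).card = q i := by omega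
    refine ⟨hq, fun b hb => ?_⟩
    by_cases hb' : (b, i) ∈ accepted (responsiveProfile q prio)
        (daState (responsiveProfile q prio) R s).considered
    · exact ihp b hb'
    -- Both accepted sets have `q i` elements, so the newcomer `b` comes with a displaced `c`; then
    -- `b` outranks `c`, and `c` outranks `a` by induction.
    obtain ⟨c, hc1, hc2⟩ := exists_mem_notMem_of_card_le (ihc.ge.trans' hq.le)
      (mem_instPart.2 hb) (fun hb'' => hb' (mem_instPart.1 hb''))
    rw [mem_instPart] at hc1 hc2
    exact (prio i).strict_trans (strict_of_mem_accepted q prio hb (hsub hc1) hc2) (ihp c hc1)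

/-- Agents propose acceptable contracts, in the order of their preferences. -/
theorem proposed_spec (C : I → ChoiceRule A) (s : ℕ) {a : A} {i : I}
    (h : (a, i) ∈ (daState C R s).proposed) :
    (R a).rel (some i) none ∧ ∀ j, (R a).rel (some j) none →
      (a, j) ∉ (daState C R s).proposed → (R a).rel (some i) (some j) := by
  induction s with
  | zero =>
    have := (mem_proposals.1 h).2
    refine ⟨this.1, fun j hj _ => this.2.2 j hj (by simp)⟩
  | succ s ih =>
    have hn : ∀ {j}, (a, j) ∉ (daState C R (s + 1)).proposed → (a, j) ∉ (daState C R s).proposed :=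
      fun hj hj' => hj ((mem_proposed_succ R).2 (Or.inl hj'))
    rcases (mem_proposed_succ R).1 h with h | h
    · exact ⟨(ih h).1, fun j hj hj' => (ih h).2 j hj (hn hj')⟩
    · have := (mem_proposals.1 h).2
      exact ⟨this.1, fun j hj hj' => this.2.2 j hj (hn hj')⟩

theorem exists_isNextProposal (P : Finset (A × I)) {a : A} {j : I}
    (hj : (R a).rel (some j) none) (hj' : (a, j) ∉ P) : ∃ i, IsNextProposal R P a i := by
  classical
  obtain ⟨m, hm, hb⟩ := (R a).exists_best
    ((Finset.univ.filter fun i => (R a).rel (some i) none ∧ (a, i) ∉ P).image some)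
    ⟨some j, by simp [hj, hj']⟩
  simp only [Finset.mem_image, Finset.mem_filter, Finset.mem_univ, true_and] at hm hb
  obtain ⟨i, hi, rfl⟩ := hm
  exact ⟨i, hi.1, hi.2, fun k hk hk' => hb _ ⟨k, ⟨hk, hk'⟩, rfl⟩⟩

/-- An agent who has not proposed all acceptable contracts has a contract under consideration. -/
theorem exists_considered (C : I → ChoiceRule A) (s : ℕ) {a : A} {j : I}
    (hj : (R a).rel (some j) none) (hj' : (a, j) ∉ (daState C R s).proposed) :
    ∃ i, (a, i) ∈ (daState C R s).considered := by
  classical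
  induction s with
  | zero =>
    obtain ⟨i, hi⟩ := exists_isNextProposal R ∅ hj (by simp)
    exact ⟨i, mem_proposals.2 ⟨trivial, hi⟩⟩
  | succ s ih =>
    have hn : (a, j) ∉ (daState C R s).proposed :=
      fun h => hj' ((mem_proposed_succ R).2 (Or.inl h))
    obtain ⟨k, hk⟩ := ih hn
    by_cases hk' : (a, k) ∈ accepted C (daState C R s).considered
    · exact ⟨k, (mem_considered_succ R).2 (Or.inl hk')⟩
    · obtain ⟨i, hi⟩ := exists_isNextProposal R _ hj hn
      exact ⟨i, (mem_considered_succ R).2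
        (Or.inr (mem_proposals.2 ⟨⟨k, hk, hk'⟩, hi⟩))⟩

/-- No institution ever rejects a contract of a stable matching. -/
theorem accepted_of_mem_stable {Y : Matching A I} (hY : IsStable q prio R Y) (s : ℕ) {a : A} {i : I}
    (hm : (a, i) ∈ Y.contracts) (h : (a, i) ∈ (daState (responsiveProfile q prio) R s).proposed) :
    (a, i) ∈ accepted (responsiveProfile q prio)
      (daState (responsiveProfile q prio) R s).considered := by
  classical
  -- The premise encodes that no contract of `Y` was rejected before step `s`: an agent under
  -- consideration who has proposed the own contract in `Y` is considered for that one.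
  have key : ∀ s, (∀ b i j, (b, i) ∈ (daState (responsiveProfile q prio) R s).considered →
      (b, j) ∈ (daState (responsiveProfile q prio) R s).proposed → (b, j) ∈ Y.contracts → j = i) →
      ∀ a i, (a, i) ∈ Y.contracts → (a, i) ∈ (daState (responsiveProfile q prio) R s).proposed →
        (a, i) ∈ accepted (responsiveProfile q prio)
          (daState (responsiveProfile q prio) R s).considered := by
    intro s hs a i hm h
    by_contra h'
    obtain ⟨hcard, hprio⟩ := rejected_spec q prio R s h h'
    -- The institution is full without `a`, whereas `Y` includes `a` within capacity, so some
    -- accepted `b` is not at `i` in `Y`. As `b` has not yet proposed the own contract in `Y`, `b`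
    -- prefers `i` to it and envies `a` with justification.
    obtain ⟨b, hb, hb'⟩ := exists_mem_notMem_of_card_le
      (hcard.ge.trans' (hY.nonWasteful i).1) (mem_instPart.2 hm)
      (fun h'' => h' (mem_instPart.1 h''))
    rw [mem_instPart] at hb hb'
    have hbc := accepted_subset _ _ hb
    obtain ⟨hacc, hord⟩ := proposed_spec R _ s (considered_subset_proposed _ R s hbc)
    refine hY.noJustifiedEnvy i ⟨b, a, hb', hm, ⟨?_, ?_⟩, hprio b hb⟩
    · cases hj : Y.assign b with
      | none => exact hacc
      | some j =>
        have hjY := (Y.assign_eq_some b j).1 hj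
        refine hord j (hj ▸ hY.individuallyRational b) fun hjp => hb' ?_
        rwa [← hs b i j hbc hjp hjY]
    · exact fun h => hb' ((Y.assign_eq_some b i).1 h.symm)
  induction s generalizing a i with
  | zero =>
    exact key 0 (fun b i j hi hj _ => considered_unique (responsiveProfile q prio) R 0 b j i hj hi)
      a i hm h
  | succ s ih =>
    refine key (s + 1) (fun b i j hi hj hjY => ?_) a i hm h
    by_cases hjc : (b, j) ∈ (daState (responsiveProfile q prio) R (s + 1)).considered
    · exact considered_unique _ R _ b j i hjc hi
    · obtain ⟨h1, h2⟩ := proposed_of_proposed_succ R hj hjc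
      exact (h2 (ih hjY h1)).elim

/-- The deferred-acceptance rule based on the responsive choice rules. -/
noncomputable abbrev responsiveDA : MatchingRule A I :=
  deferredAcceptance (responsiveProfile q prio)

/-- Only the absence of a rejection matters later, not that the step is the first such one. -/
theorem exists_final_step (C : I → ChoiceRule A) : ∃ s,
    (deferredAcceptance C R).contracts = accepted C (daState C R s).considered ∧
      (daState C R s).considered ⊆ accepted C (daState C R s).considered := by
  classical
  have h := Nat.find_spec (exists_noRejection C R)
  exact ⟨_, rfl, Finset.sdiff_eq_empty_iff_subset.1 h⟩

/-- A contract that an agent prefers to the final assignment was proposed and rejected (`hrej`),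
since proposals go down the preference. `rejected_spec` then yields both non-wastefulness and
absence of justified envy. -/
theorem isStable_responsiveDA : IsStable q prio R (responsiveDA q prio R) := by
  obtain ⟨s, hX, hfin⟩ := exists_final_step R (responsiveProfile q prio)
  have hprop : ∀ a i, (a, i) ∈ (responsiveDA q prio R).contracts →
      (a, i) ∈ (daState (responsiveProfile q prio) R s).proposed := fun a i h =>
    considered_subset_proposed _ R s (accepted_subset _ _ (hX.subset h))
  have hir : IndividuallyRational R (responsiveDA q prio R) := by
    intro a
    cases h : (responsiveDA q prio R).assign a with
    | none => exact (R a).rel_refl _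
    | some i => exact (proposed_spec R _ s (hprop a i ((Matching.assign_eq_some _ a i).1 h))).1
  have hrej : ∀ a i, (R a).strict (some i) ((responsiveDA q prio R).assign a) →
      (a, i) ∈ (daState (responsiveProfile q prio) R s).proposed ∧
      (a, i) ∉ accepted (responsiveProfile q prio)
        (daState (responsiveProfile q prio) R s).considered := by
    intro a i h
    constructor
    · by_contra hn
      have hacc := (R a).rel_trans h.1 (hir a)
      obtain ⟨j, hj⟩ := exists_considered R _ s hacc hn
      have hj' := (Matching.assign_eq_some _ a j).2 (hX.symm.subset (hfin hj))
      rw [hj'] at h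
      exact h.2 ((R a).rel_antisymm h.1
        ((proposed_spec R _ s (considered_subset_proposed _ R s hj)).2 i hacc hn))
    · exact fun hn => h.2 ((Matching.assign_eq_some _ a i).2 (hX.symm.subset hn)).symm
  refine ⟨fun i => ⟨?_, fun a h => ?_⟩, ?_, hir⟩
  · rw [hX, card_instPart_accepted]
    exact min_le_left _ _
  · rw [hX]
    exact (rejected_spec q prio R s (hrej a i h).1 (hrej a i h).2).1
  · rintro i ⟨a, b, -, hb, h, hab⟩
    have hba := (rejected_spec q prio R s (hrej a i h).1 (hrej a i h).2).2 b (hX.subset hb)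
    exact hab.2 ((prio i).rel_antisymm hab.1 hba.1)

/-- Deferred acceptance is optimal for the agents among the stable matchings. -/
theorem responsiveDA_rel_of_isStable {Y : Matching A I} (hY : IsStable q prio R Y) (a : A) :
    (R a).rel ((responsiveDA q prio R).assign a) (Y.assign a) := by
  obtain ⟨s, hX, hfin⟩ := exists_final_step R (responsiveProfile q prio)
  cases h : Y.assign a with
  | none => exact (isStable_responsiveDA q prio R).individuallyRational a
  | some j =>
    have hacc : (R a).rel (some j) none := h ▸ hY.individuallyRational a
    -- If proposed, the contract of `Y` was never rejected and is the final one; otherwise `a` ends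
    -- with a contract proposed ahead of it.
    by_cases hp : (a, j) ∈ (daState (responsiveProfile q prio) R s).proposed
    · have hj := accepted_of_mem_stable q prio R hY s ((Y.assign_eq_some a j).1 h) hp
      rw [(Matching.assign_eq_some _ a j).2 (hX.symm.subset hj)]
      exact (R a).rel_refl _
    · obtain ⟨k, hk⟩ := exists_considered R _ s hacc hp
      rw [(Matching.assign_eq_some _ a k).2 (hX.symm.subset (hfin hk))]
      exact (proposed_spec R _ s (considered_subset_proposed _ R s hk)).2 j hacc hp

end Invariants

/-! ### Matched agents -/

section Matched

variable {q : I → ℕ} {prio : I → Priority A} {R : Problem A I}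

open Classical in
theorem card_contracts_eq_sum (X : Matching A I) :
    X.contracts.card = ∑ i, (instPart X.contracts i).card := by
  rw [Finset.card_eq_sum_card_fiberwise (f := Prod.snd) (t := Finset.univ) (by simp)]
  refine Finset.sum_congr rfl fun i _ => ?_
  refine Finset.card_bij' (fun x _ => x.1) (fun a _ => (a, i)) ?_ ?_ ?_ ?_
  · rintro ⟨a, j⟩ h
    rw [Finset.mem_filter] at h
    rw [mem_instPart, ← h.2]
    exact h.1
  · intro a h
    simpa using mem_instPart.1 h
  · rintro ⟨a, j⟩ h
    rw [Finset.mem_filter] at h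
    rw [← h.2]
  · intro a h
    rfl

open Classical in
theorem card_contracts_eq_card_matched (X : Matching A I) :
    X.contracts.card = (Finset.univ.filter fun a => X.assign a ≠ none).card := by
  have himg : (Finset.univ.filter fun a => X.assign a ≠ none) = X.contracts.image Prod.fst := by
    ext a
    simp [Matching.assign_eq_none]
  rw [himg, Finset.card_image_of_injOn]
  rintro ⟨a, i⟩ h ⟨b, j⟩ h' hab
  obtain rfl : a = b := hab
  have h1 := (X.assign_eq_some a i).2 h
  have h2 := (X.assign_eq_some a j).2 h'
  rw [h1] at h2
  rw [Option.some.inj h2]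

/-- Every stable matching matches the agents that deferred acceptance matches. -/
theorem matched_of_matched_responsiveDA {Y : Matching A I} (hY : IsStable q prio R Y) {a : A}
    (ha : (responsiveDA q prio R).assign a ≠ none) : Y.assign a ≠ none := by
  classical
  have hX := isStable_responsiveDA q prio R
  have hopt := responsiveDA_rel_of_isStable q prio R hY
  have hcard : (responsiveDA q prio R).contracts.card ≤ Y.contracts.card := by
    rw [card_contracts_eq_sum, card_contracts_eq_sum]
    refine Finset.sum_le_sum fun i _ => ?_
    by_cases hfull : (instPart Y.contracts i).card = q i
    · exact (hX.nonWasteful i).1.trans hfull.ge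
    -- An institution with a free place in `Y` is desired by nobody there, so by optimality each
    -- agent it gets under deferred acceptance is already with it in `Y`.
    · refine Finset.card_le_card fun b hb => ?_
      have hbX := (Matching.assign_eq_some _ b i).2 (mem_instPart.1 hb)
      have hb' := hopt b
      rw [hbX] at hb'
      by_contra hn
      refine hfull ((hY.nonWasteful i).2 b ⟨hb', fun h => hn ?_⟩)
      exact mem_instPart.2 ((Y.assign_eq_some b i).1 h.symm)
  rw [card_contracts_eq_card_matched, card_contracts_eq_card_matched] at hcard
  -- Optimality and individual rationality give the opposite inclusion of matched agents, so the
  -- cardinalities force equality.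
  have hsub : (Finset.univ.filter fun a => Y.assign a ≠ none) ⊆
      Finset.univ.filter fun a => (responsiveDA q prio R).assign a ≠ none := by
    intro b hb
    simp only [Finset.mem_filter, Finset.mem_univ, true_and] at hb ⊢
    intro hn
    have h := hopt b
    rw [hn] at h
    exact hb ((R b).rel_antisymm (hY.individuallyRational b) h)
  have hmem := (Finset.eq_of_subset_of_card_le hsub hcard).symm.subset
    (Finset.mem_filter.2 ⟨Finset.mem_univ a, ha⟩)
  exact (Finset.mem_filter.1 hmem).2

open Classical in
/-- A stable matching remains stable when an agent's preference changes such that the assignment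
stays acceptable and every contract that the agent now prefers was preferred before. -/
theorem IsStable.update {X : Matching A I} (hX : IsStable q prio R X) {a : A} {P : Preference I}
    (hir : P.rel (X.assign a) none)
    (hP : ∀ i, P.strict (some i) (X.assign a) → (R a).strict (some i) (X.assign a)) :
    IsStable q prio (Function.update R a P) X := by
  have hall : ∀ b i, (Function.update R a P b).strict (some i) (X.assign b) →
      (R b).strict (some i) (X.assign b) := by
    intro b i h
    by_cases hb : b = a
    · subst hb
      rw [Function.update_self] at h
      exact hP i h
    · rwa [Function.update_of_ne hb] at h
  refine ⟨fun i => ⟨(hX.nonWasteful i).1, fun b h => (hX.nonWasteful i).2 b (hall b i h)⟩, ?_, ?_⟩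
  · rintro i ⟨b, c, h1, h2, h3, h4⟩
    exact hX.noJustifiedEnvy i ⟨b, c, h1, h2, hall b i h3, h4⟩
  · intro b
    by_cases hb : b = a
    · subst hb
      rwa [Function.update_self]
    · rw [Function.update_of_ne hb]
      exact hX.individuallyRational b

open Classical in
/-- An agent who gets institution `i` in some stable matching gets a contract in every stable
matching when the agent's preference changes to accepting only `i`. -/
theorem IsStable.matched_of_acceptOnly_singleton {X : Matching A I} (hX : IsStable q prio R X)
    {a : A} {i : I} (hi : X.assign a = some i) {P : Preference I} {Y : Matching A I}
    (hY : IsStable q prio (Function.update R a (acceptOnly P {i})) Y) : Y.assign a ≠ none := by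
  have hX' : IsStable q prio (Function.update R a (acceptOnly P {i})) X := by
    refine hX.update ?_ fun j hj => ?_
    · rw [hi]
      exact acceptOnly_rel_some_none.2 rfl
    · rw [hi] at hj
      have := ((acceptOnly_rel_some_some (Set.mem_singleton i)).1 hj.1).1
      exact (hj.2 (congrArg some this)).elim
  refine matched_of_matched_responsiveDA hY fun hn => ?_
  have h := responsiveDA_rel_of_isStable q prio _ hX' a
  rw [hn, Function.update_self, hi] at h
  exact Option.some_ne_none i
    (LinearRel.rel_antisymm _ (acceptOnly_rel_some_none.2 (Set.mem_singleton i)) h)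

/-- Suppose misreporting gains `i`, and let `Z` be the outcome when `a` truthfully ranks only the
set `S` of contracts at least as good as `i`. Being unmatched in `Z` contradicts the counting
result, being matched contradicts optimality under `R`. -/
theorem strategyProof_responsiveDA : StrategyProof (responsiveDA q prio) := by
  classical
  intro R a R'
  by_contra hcon
  have hgain := (R a).not_rel_iff_strict.1 hcon
  have hX := isStable_responsiveDA q prio R
  have hX' := isStable_responsiveDA q prio (Function.update R a R')
  cases hi : (responsiveDA q prio (Function.update R a R')).assign a with
  | none => exact hcon (hi ▸ hX.individuallyRational a)
  | some i =>
    rw [hi] at hgain hcon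
    set S : Set I := {j | (R a).rel (some j) (some i)}
    have hiS : i ∈ S := (R a).rel_refl _
    have hZ := isStable_responsiveDA q prio (Function.update R a (acceptOnly (R a) S))
    set Z := responsiveDA q prio (Function.update R a (acceptOnly (R a) S))
    cases hk : Z.assign a with
    | none =>
      -- Shrinking the acceptable set from `S` to `{i}` creates no new desires for an unmatched
      -- agent, so `Z` stays stable.
      have hZ' := hZ.update (a := a) (P := acceptOnly (R a) {i})
        (hk ▸ LinearRel.rel_refl _ _) fun j hj => by
          rw [hk] at hj ⊢
          have hji : j = i := Set.mem_singleton_iff.1 (acceptOnly_rel_some_none.1 hj.1)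
          rw [Function.update_self]
          exact ⟨acceptOnly_rel_some_none.2 (hji ▸ hiS), Option.some_ne_none j⟩
      rw [Function.update_idem] at hZ'
      -- The profile is now read as a change of the misreported one, at which a stable matching
      -- gives `i` to `a`.
      rw [← Function.update_idem (a := a) R' _ R] at hZ'
      exact hX'.matched_of_acceptOnly_singleton hi hZ' hk
    | some k =>
      have hkS : k ∈ S := by
        have := hZ.individuallyRational a
        rw [Function.update_self, hk] at this
        exact acceptOnly_rel_some_none.1 this
      -- Every contract better than `k` lies in `S` and is ranked there as in `R a`, so `Z` is
      -- stable under the true preferences.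
      have hZ' := hZ.update (a := a) (P := R a)
        (by
          rw [hk]
          exact (R a).rel_trans hkS ((R a).rel_trans hgain.1 (hX.individuallyRational a)))
        fun j hj => by
          rw [hk] at hj ⊢
          rw [Function.update_self]
          exact ⟨(acceptOnly_rel_some_some hkS).2 ⟨(R a).rel_trans hj.1 hkS, hj.1⟩, hj.2⟩
      rw [Function.update_idem, Function.update_eq_self] at hZ'
      have h := responsiveDA_rel_of_isStable q prio R hZ' a
      rw [hk] at h
      exact hcon ((R a).rel_trans h hkS)

/-- Reporting only `i` secures `i` under `φ`, so by strategy-proofness the truthful outcome is no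
worse than `i`; agent-optimality gives the reverse comparison. -/
theorem eq_responsiveDA_of_isStable_of_strategyProof {φ : MatchingRule A I}
    (hst : ∀ R, IsStable q prio R (φ R)) (hsp : StrategyProof φ) : φ = responsiveDA q prio := by
  classical
  funext R
  refine Matching.ext_assign fun a => ?_
  have hX := isStable_responsiveDA q prio R
  have hopt := responsiveDA_rel_of_isStable q prio R (hst R) a
  cases hi : (responsiveDA q prio R).assign a with
  | none =>
    rw [hi] at hopt
    exact (R a).rel_antisymm ((hst R).individuallyRational a) hopt
  | some i =>
    rw [hi] at hopt
    have hY := hst (Function.update R a (acceptOnly (R a) {i}))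
    have hm := hX.matched_of_acceptOnly_singleton hi hY
    have hsp' := hsp R a (acceptOnly (R a) {i})
    have hir := hY.individuallyRational a
    obtain ⟨j, hj⟩ := Option.ne_none_iff_exists'.1 hm
    rw [Function.update_self, hj] at hir
    obtain rfl : j = i := Set.mem_singleton_iff.1 (acceptOnly_rel_some_none.1 hir)
    rw [hj] at hsp'
    exact (R a).rel_antisymm hsp' hopt

end Matched

end Finite

end ContractMatching

open ContractMatching
theorem mainTheorem8 {A I : Type*} [Fintype A] [Fintype I]
    (q : I → ℕ) (prio : I → Priority A) (φ : MatchingRule A I) :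
    ((∀ R, NonWasteful q R (φ R)) ∧ (∀ R, NoJustifiedEnvy prio R (φ R)) ∧
        (∀ R, IndividuallyRational R (φ R)) ∧ StrategyProof φ) ↔
      φ = deferredAcceptance (fun i => responsive (q i) (prio i)) := by
  constructor
  · rintro ⟨hnw, hne, hir, hsp⟩
    exact eq_responsiveDA_of_isStable_of_strategyProof (fun R => ⟨hnw R, hne R, hir R⟩) hsp
  · rintro rfl
    have hst := isStable_responsiveDA q prio
    exact ⟨fun R => (hst R).nonWasteful, fun R => (hst R).noJustifiedEnvy,
      fun R => (hst R).individuallyRational, strategyProof_responsiveDA⟩
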